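/- Let $K$ be a field, let $P=K[x_1,\dots,x_n]$, let $I\subset P$ be an ideal such that $R=P/I$ has Krull dimension $0$ (in particular $I\neq P$), and let $\mathcal F=(F_iR)_{i\in\mathbb Z}$ be the degree filtration of $R$, i.e. $F_iR$ is the image in $R$ of $F_iP=\{f\in P\mid \deg f\le i\}\cup\{0\}$. Let $\mathrm{HF}^a_R(i)=\dim_K F_iR$ be the affine Hilbert function, $\mathrm{ri}(R)=\min\{i\in\mathbb Z\mid \mathrm{HF}^a_R(j)=\dim_K R\text{ for all }j\ge i\}$ the regularity index, and $\Delta_R=\mathrm{HF}^a_R(\mathrm{ri}(R))-\mathrm{HF}^a_R(\mathrm{ri}(R)-1)$ the last difference. Let $\mathrm{gr}_{\mathcal F}(R)=\bigoplus_{i\in\mathbb Z}F_iR/F_{i-1}R$ be the associated graded ring, viewed as a $0$-dimensional affine $K$-algebra through $P\to \mathrm{gr}_{\mathcal F}(R)$, $x_k\mapsto \bar x_k+F_0R\in F_1R/F_0R$. Definitions. (1) $R$ is a *strict Gorenstein ring* if $\mathrm{gr}_{\mathcal F}(R)$ is a local Gorenstein ring, i.e. it is an Artinian local ring whose socle (the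 annihilator of the maximal ideal) is one-dimensional over the residue field. (2) Let $A$ be a $0$-dimensional affine $K$-algebra with a given presentation as a quotient of $P$ and the corresponding degree filtration, and let $\langle 0\rangle=\mathfrak q_1\cap\dots\cap\mathfrak q_s$ be the primary decomposition in $A$, with $\mathfrak m_i=\mathrm{Rad}(\mathfrak q_i)$. A *minimal divisor* at $\mathfrak m_i$ is an ideal $J=\mathfrak q_1\cap\dots\cap\mathfrak q_i'\cap\dots\cap\mathfrak q_s$ of $A$, where $\mathfrak q_i'\supsetneq\mathfrak q_i$ is an ideal ($\mathfrak q_i'=A$ is allowed), such that $\dim_K J=\dim_K A/\mathfrak m_i$. The order of $f\in A\setminus\{0\}$ is the $d\in\mathbb Z$ with $f\in F_dA\setminus F_{d-1}A$; $\mathrm{ri}(J)$ is the maximal order of a non-zero element of $J$, and $\mathrm{sepdeg}(\mathfrak m_i)$ is the minimum of $\mathrm{ri}(J)$ over all minimal divisors $J$ at $\mathfrak m_i$. The algebra $A$ has the *Cayley-Bacharach property* if $\mathrm{sepdeg}(\mathfrak m_i)=\mathrm{ri}(A)$ for $i=1,\dots,s$. (3) $R$ has the *strict Cayley-Bacharach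 property* if $\mathrm{gr}_{\mathcal F}(R)$ has the Cayley-Bacharach property. Theorem. The following conditions are equivalent: (a) $R$ is a strict Gorenstein ring. (b) $R$ has the strict Cayley-Bacharach property and $\Delta_R=1$. -/

import Mathlib

open scoped DirectSum

noncomputable section

namespace ZeroDimAffine

/-! ### Degree filtrations -/

section Filtration

variable {K : Type*} [Field K] {n : ℕ}

/-- The degree filtration of the polynomial ring `P = K[x_1, …, x_n]`:
`F_i P = {f ∈ P ∣ deg f ≤ i} ∪ {0}` for `i ∈ ℤ`. -/
def polyFiltration (K : Type*) [Field K] (n : ℕ) (i : ℤ) :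
    Submodule K (MvPolynomial (Fin n) K) where
  carrier := {f | f = 0 ∨ (f.totalDegree : ℤ) ≤ i}
  zero_mem' := Or.inl rfl
  add_mem' := by
    rintro f g hf hg
    rcases hf with rfl | hf
    · simpa using hg
    rcases hg with rfl | hg
    · rw [add_zero]; exact Or.inr hf
    · have := MvPolynomial.totalDegree_add f g
      exact Or.inr (by omega)
  smul_mem' := by
    rintro c f (rfl | hf)
    · exact Or.inl (smul_zero c)
    · have := MvPolynomial.totalDegree_smul_le c f
      exact Or.inr (by omega)

theorem one_mem_polyFiltration : (1 : MvPolynomial (Fin n) K) ∈ polyFiltration K n 0 :=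
  Or.inr (by simp)

theorem X_mem_polyFiltration (k : Fin n) :
    (MvPolynomial.X k : MvPolynomial (Fin n) K) ∈ polyFiltration K n 1 :=
  Or.inr (by simp)

theorem mul_mem_polyFiltration {i j : ℤ} {f g : MvPolynomial (Fin n) K}
    (hf : f ∈ polyFiltration K n i) (hg : g ∈ polyFiltration K n j) :
    f * g ∈ polyFiltration K n (i + j) := by
  rcases hf with rfl | hf
  · exact Or.inl (zero_mul g)
  rcases hg with rfl | hg
  · exact Or.inl (mul_zero f)
  · have := MvPolynomial.totalDegree_mul f g
    exact Or.inr (by omega)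

variable {A : Type*} [CommRing A] [Algebra K A]

/-- The degree filtration of an affine algebra `A` with the presentation `π : P → A`:
`F_i A` is the image of `F_i P`. For `A = P/I` it is `F_i P / (F_i P ∩ I)`. -/
def degFiltration (π : MvPolynomial (Fin n) K →ₐ[K] A) (i : ℤ) : Submodule K A :=
  (polyFiltration K n i).map π.toLinearMap

instance (π : MvPolynomial (Fin n) K →ₐ[K] A) : SetLike.GradedMonoid (degFiltration π) where
  one_mem := ⟨1, one_mem_polyFiltration, map_one π⟩
  mul_mem := by
    rintro i j _ _ ⟨f, hf, rfl⟩ ⟨g, hg, rfl⟩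
    exact ⟨f * g, mul_mem_polyFiltration hf hg, map_mul π f g⟩

end Filtration

/-! ### Invariants of a filtered algebra -/

section Invariants

variable {K : Type*} [Field K] {A : Type*} [CommRing A] [Algebra K A]

/-- The affine Hilbert function `HF^a(i) = dim_K F_i A`. -/
def affineHF (F : ℤ → Submodule K A) (i : ℤ) : ℤ :=
  Module.finrank K (F i)

/-- The regularity index `ri = min {i ∈ ℤ ∣ HF^a(j) = dim_K A for all j ≥ i}`. -/
def regIndex (F : ℤ → Submodule K A) : ℤ :=
  sInf {i : ℤ | ∀ j : ℤ, i ≤ j → affineHF F j = Module.finrank K A}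

/-- The last difference `Δ = HF^a(ri) - HF^a(ri - 1)`. -/
def lastDifference (F : ℤ → Submodule K A) : ℤ :=
  affineHF F (regIndex F) - affineHF F (regIndex F - 1)

/-- The order `min {i ∈ ℤ ∣ f ∈ F_i A \ F_{i-1} A}` of a non-zero element `f`. -/
def order (F : ℤ → Submodule K A) (f : A) : ℤ :=
  sInf {i : ℤ | f ∈ F i ∧ f ∉ F (i - 1)}

/-- The maximal order `ri(J)` of a non-zero element of the ideal `J`. -/
def idealRegIndex (F : ℤ → Submodule K A) (J : Ideal A) : ℤ :=
  sSup {d : ℤ | ∃ f ∈ J, f ≠ 0 ∧ order F f = d}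

open Classical in
/-- `J` is the image in `A` of a minimal divisor at the maximal ideal `m` of the defining ideal:
if `⟨0⟩ = q_1 ∩ ⋯ ∩ q_s` is the primary decomposition, and `q = q_i` is the component with
radical `m`, then `J = q_1 ∩ ⋯ ∩ q' ∩ ⋯ ∩ q_s`, where `q` is replaced by some ideal `q'`
strictly containing it (`q' = ⟨1⟩` is allowed), and `dim_K J = dim_K A/m`. -/
def IsMinimalDivisor (K : Type*) [Field K] {A : Type*} [CommRing A] [Algebra K A]
    (m J : Ideal A) : Prop :=
  ∃ t : Finset (Ideal A), Submodule.IsMinimalPrimaryDecomposition (⊥ : Ideal A) t ∧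
    ∃ q ∈ t, q.radical = m ∧
      (∃ q' : Ideal A, q < q' ∧ J = q' ⊓ (t.erase q).inf id) ∧
      Module.finrank K J = Module.finrank K (A ⧸ m)

/-- The separator degree of the maximal ideal `m`: the minimum of the numbers `ri(J)` over all
minimal divisors `J` at `m`. -/
def sepDegree (F : ℤ → Submodule K A) (m : Ideal A) : ℤ :=
  sInf {d : ℤ | ∃ J : Ideal A, IsMinimalDivisor K m J ∧ idealRegIndex F J = d}

/-- The Cayley-Bacharach property: all separator degrees are equal to the regularity index. -/
def HasCBP (F : ℤ → Submodule K A) : Prop :=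
  ∀ m : Ideal A, m.IsMaximal → sepDegree F m = regIndex F

end Invariants

/-! ### The associated graded ring of a `ℤ`-filtration -/

section Graded

variable {K : Type*} [Field K] {A : Type*} [CommRing A] [Algebra K A]

/-- The graded piece `F_i A / F_{i-1} A`. -/
def GrPiece (F : ℤ → Submodule K A) (i : ℤ) : Type _ :=
  F i ⧸ (F (i - 1)).submoduleOf (F i)

instance (F : ℤ → Submodule K A) (i : ℤ) : AddCommGroup (GrPiece F i) :=
  inferInstanceAs (AddCommGroup (F i ⧸ (F (i - 1)).submoduleOf (F i)))

instance (F : ℤ → Submodule K A) (i : ℤ) : Module K (GrPiece F i) :=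
  inferInstanceAs (Module K (F i ⧸ (F (i - 1)).submoduleOf (F i)))

/-- The residue class map `F_i A → F_i A / F_{i-1} A`. -/
def GrPiece.mk (F : ℤ → Submodule K A) (i : ℤ) : F i →ₗ[K] GrPiece F i :=
  ((F (i - 1)).submoduleOf (F i)).mkQ

variable {F : ℤ → Submodule K A}

theorem GrPiece.mk_surjective {i : ℤ} (a : GrPiece F i) : ∃ x : F i, GrPiece.mk F i x = a :=
  Submodule.mkQ_surjective _ a

theorem GrPiece.mk_eq_zero {i : ℤ} (x : F i) : GrPiece.mk F i x = 0 ↔ (x : A) ∈ F (i - 1) :=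
  Submodule.Quotient.mk_eq_zero _

theorem GrPiece.mk_congr {i j : ℤ} {x : F i} {y : F j} (hij : i = j) (hxy : (x : A) = y) :
    (GradedMonoid.mk i (GrPiece.mk F i x) : GradedMonoid (GrPiece F)) =
      GradedMonoid.mk j (GrPiece.mk F j y) := by
  subst hij
  rw [Subtype.ext hxy]

variable [SetLike.GradedMonoid F]

/-- The multiplication `F_i A × F_j A → F_{i+j} A` of `A`. -/
def filMul (F : ℤ → Submodule K A) [SetLike.GradedMonoid F] (i j : ℤ) :
    F i →ₗ[K] F j →ₗ[K] F (i + j) :=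
  LinearMap.mk₂ K (fun x y => ⟨(x : A) * y, SetLike.mul_mem_graded x.2 y.2⟩)
    (fun x x' y => Subtype.ext (add_mul (x : A) x' y))
    (fun c x y => Subtype.ext (smul_mul_assoc c (x : A) y))
    (fun x y y' => Subtype.ext (mul_add (x : A) y y'))
    (fun c x y => Subtype.ext (mul_smul_comm c (x : A) y))

theorem coe_filMul {i j : ℤ} (x : F i) (y : F j) : (filMul F i j x y : A) = x * y :=
  rfl

/-- The multiplication `(F_i A / F_{i-1} A) × (F_j A / F_{j-1} A) → F_{i+j} A / F_{i+j-1} A`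
induced by the multiplication of `A`. -/
def GrPiece.mul (F : ℤ → Submodule K A) [SetLike.GradedMonoid F] (i j : ℤ) :
    GrPiece F i →ₗ[K] GrPiece F j →ₗ[K] GrPiece F (i + j) :=
  Submodule.liftQ ((F (i - 1)).submoduleOf (F i))
    (LinearMap.flip
      (Submodule.liftQ ((F (j - 1)).submoduleOf (F j))
        ((filMul F i j).compr₂ (GrPiece.mk F (i + j))).flip
        (by
          intro y hy
          refine LinearMap.mem_ker.2 (LinearMap.ext fun x => (GrPiece.mk_eq_zero _).2 ?_)
          have h := SetLike.mul_mem_graded (A := F) x.2 (show (y : A) ∈ F (j - 1) from hy)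
          rwa [← add_sub_assoc] at h)))
    (by
      intro x hx
      refine LinearMap.mem_ker.2 (LinearMap.ext fun b => ?_)
      obtain ⟨y, rfl⟩ := Submodule.mkQ_surjective _ b
      refine (GrPiece.mk_eq_zero (filMul F i j x y)).2 ?_
      have h := SetLike.mul_mem_graded (A := F) (show (x : A) ∈ F (i - 1) from hx) y.2
      rwa [sub_add_eq_add_sub] at h)

theorem GrPiece.mul_mk {i j : ℤ} (x : F i) (y : F j) :
    GrPiece.mul F i j (GrPiece.mk F i x) (GrPiece.mk F j y) =
      GrPiece.mk F (i + j) (filMul F i j x y) :=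
  rfl

instance : GradedMonoid.GOne (GrPiece F) where
  one := GrPiece.mk F 0 ⟨1, SetLike.GradedOne.one_mem⟩

instance : GradedMonoid.GMul (GrPiece F) where
  mul {i j} a b := GrPiece.mul F i j a b

instance : GradedMonoid.GMonoid (GrPiece F) where
  one_mul := by
    rintro ⟨i, a⟩
    obtain ⟨x, rfl⟩ := GrPiece.mk_surjective a
    exact GrPiece.mk_congr (zero_add i) (one_mul (x : A))
  mul_one := by
    rintro ⟨i, a⟩
    obtain ⟨x, rfl⟩ := GrPiece.mk_surjective a
    exact GrPiece.mk_congr (add_zero i) (mul_one (x : A))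
  mul_assoc := by
    rintro ⟨i, a⟩ ⟨j, b⟩ ⟨k, c⟩
    obtain ⟨x, rfl⟩ := GrPiece.mk_surjective a
    obtain ⟨y, rfl⟩ := GrPiece.mk_surjective b
    obtain ⟨z, rfl⟩ := GrPiece.mk_surjective c
    exact GrPiece.mk_congr (add_assoc i j k) (mul_assoc (x : A) y z)

instance : DirectSum.GCommRing (GrPiece F) where
  mul_zero a := map_zero _
  zero_mul b := LinearMap.congr_fun (map_zero _) b
  mul_add a b c := map_add _ b c
  add_mul a b c := LinearMap.congr_fun (map_add _ a b) c
  mul_comm := by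
    rintro ⟨i, a⟩ ⟨j, b⟩
    obtain ⟨x, rfl⟩ := GrPiece.mk_surjective a
    obtain ⟨y, rfl⟩ := GrPiece.mk_surjective b
    exact GrPiece.mk_congr (add_comm i j) (mul_comm (x : A) y)
  natCast m := m • GrPiece.mk F 0 ⟨1, SetLike.GradedOne.one_mem⟩
  natCast_zero := zero_smul ℕ _
  natCast_succ m := succ_nsmul _ m
  intCast m := m • GrPiece.mk F 0 ⟨1, SetLike.GradedOne.one_mem⟩
  intCast_ofNat m := natCast_zsmul _ m
  intCast_negSucc_ofNat m := negSucc_zsmul _ m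

instance : DirectSum.GAlgebra K (GrPiece F) where
  toFun := ((GrPiece.mk F 0).comp
    (LinearMap.toSpanSingleton K (F 0) ⟨1, SetLike.GradedOne.one_mem⟩)).toAddMonoidHom
  map_one := congrArg (GrPiece.mk F 0) (one_smul K _)
  map_mul c d := GrPiece.mk_congr (add_zero 0).symm
    (show (c * d) • (1 : A) = c • (1 : A) * d • (1 : A) by rw [smul_mul_smul_comm, one_mul])
  commutes := by
    rintro c ⟨i, a⟩
    obtain ⟨x, rfl⟩ := GrPiece.mk_surjective a
    exact GrPiece.mk_congr (add_comm 0 i) (mul_comm (c • (1 : A)) x)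
  smul_def := by
    rintro c ⟨i, a⟩
    obtain ⟨x, rfl⟩ := GrPiece.mk_surjective a
    exact GrPiece.mk_congr (x := c • x) (zero_add i).symm (smul_one_mul c (x : A)).symm

end Graded

/-- The associated graded ring `gr_F(A) = ⨁_{i ∈ ℤ} F_i A / F_{i-1} A`. -/
abbrev Gr {K : Type*} [Field K] {A : Type*} [CommRing A] [Algebra K A]
    (F : ℤ → Submodule K A) : Type _ :=
  ⨁ i : ℤ, GrPiece F i

/-! ### Zero-dimensional Gorenstein local rings -/

/-- A zero-dimensional Gorenstein local ring: an Artinian local ring `(A, m)` whose socle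
`Soc(A) = Ann_A(m)` has dimension one over the residue field `A/m`. -/
structure IsZeroDimGorensteinLocal (A : Type*) [CommRing A] : Prop where
  artinian : IsArtinianRing A
  isLocal : IsLocalRing A
  socle : Module.finrank (A ⧸ IsLocalRing.maximalIdeal A)
    (Submodule.torsionBySet A A (IsLocalRing.maximalIdeal A : Set A)) = 1

/-! ### The algebra `R = P/I` and its graded ring -/

section Quotient

variable {K : Type*} [Field K] {n : ℕ} (I : Ideal (MvPolynomial (Fin n) K))

/-- The degree filtration of `R = P/I`. -/
abbrev quotFiltration : ℤ → Submodule K (MvPolynomial (Fin n) K ⧸ I) :=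
  degFiltration (Ideal.Quotient.mkₐ K I)

/-- The presentation `P → gr_F(R)`, sending `x_k` to the residue class in `F_1 R / F_0 R` of the
image of `x_k` in `R`. It identifies `gr_F(R)` with the quotient of `P` by the degree form ideal
of `I`. -/
def grPresentation : MvPolynomial (Fin n) K →ₐ[K] Gr (quotFiltration I) :=
  MvPolynomial.aeval fun k =>
    DirectSum.of (GrPiece (quotFiltration I)) 1
      (GrPiece.mk (quotFiltration I) 1
        ⟨Ideal.Quotient.mkₐ K I (MvPolynomial.X k),
          MvPolynomial.X k, X_mem_polyFiltration k, rfl⟩)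

/-- `R = P/I` is a strict Gorenstein ring: `gr_F(R)` is a local Gorenstein ring. -/
def IsStrictGorenstein : Prop :=
  IsZeroDimGorensteinLocal (Gr (quotFiltration I))

/-- `R = P/I` has the strict Cayley-Bacharach property: the affine algebra `gr_F(R)`, with its
degree filtration, has the Cayley-Bacharach property. -/
def HasStrictCBP : Prop :=
  HasCBP (degFiltration (grPresentation I))

end Quotient

end ZeroDimAffine

end

/-!
The associated graded ring `gr(R)` of the degree filtration is a finite local `K`-algebra: its
elements of positive degree generate a nilpotent ideal with residue field `K`. Hence the minimal
divisors at the maximal ideal are exactly the minimal non-zero ideals, which are the lines in the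
socle, and the Cayley-Bacharach property says that no non-zero socle element lies in the sum `W` of
the graded pieces of degree less than `ri(R)`. The top piece `T`, of degree `ri(R)` and dimension
`Δ_R`, is contained in the socle `S` and is a complement of the proper subspace `W`. Therefore
`dim S = 1` if and only if `S ∩ W = 0` and `dim T = 1`.
-/

noncomputable section

namespace ZeroDimAffine

/-! ### Regularity index and order of a finite filtration -/

theorem exists_forall_iff_le {P : ℤ → Prop} (hP : Monotone P) (hfalse : ∃ i, ¬ P i)
    (htrue : ∃ i, P i) : ∃ d, ∀ i, P i ↔ d ≤ i := by
  obtain ⟨b, hb⟩ := hfalse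
  obtain ⟨d, hd, hmin⟩ := Int.exists_least_of_bdd
    ⟨b, fun i hi => (lt_of_not_ge fun hib => hb (hP hib hi)).le⟩ htrue
  exact ⟨d, fun i => ⟨hmin i, fun hdi => hP hdi hd⟩⟩

section FiniteFiltration

variable {K : Type*} [Field K] {A : Type*} [CommRing A] [Algebra K A]

/-- A finite filtration of an algebra: an increasing `ℤ`-filtration by subspaces which is zero in
small degrees and everything in large degrees. -/
structure IsFiniteFiltration (F : ℤ → Submodule K A) : Prop where
  monotone : Monotone F
  exists_eq_bot : ∃ i, F i = ⊥
  exists_eq_top : ∃ i, F i = ⊤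

theorem affineHF_eq_finrank_iff [Module.Finite K A] {F : ℤ → Submodule K A} {i : ℤ} :
    affineHF F i = Module.finrank K A ↔ F i = ⊤ := by
  rw [affineHF, Nat.cast_inj]
  exact ⟨Submodule.eq_top_of_finrank_eq, fun h => h ▸ finrank_top K A⟩

namespace IsFiniteFiltration

variable {F : ℤ → Submodule K A}

theorem regIndex_le_iff [Nontrivial A] [Module.Finite K A] (hF : IsFiniteFiltration F) {i : ℤ} :
    regIndex F ≤ i ↔ F i = ⊤ := by
  obtain ⟨b, hb⟩ := hF.exists_eq_bot
  obtain ⟨d, hd⟩ := exists_forall_iff_le (P := fun i => F i = ⊤)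
    (fun _ _ hij h => top_unique (h.ge.trans (hF.monotone hij)))
    ⟨b, hb ▸ bot_ne_top⟩ hF.exists_eq_top
  have hset : {i : ℤ | ∀ j, i ≤ j → affineHF F j = Module.finrank K A} = Set.Ici d := by
    ext i
    simp only [Set.mem_ofPred_eq, affineHF_eq_finrank_iff, hd, Set.mem_Ici]
    exact ⟨fun h => h i le_rfl, fun h j hij => h.trans hij⟩
  rw [regIndex, hset, csInf_Ici, hd]

theorem apply_regIndex [Nontrivial A] [Module.Finite K A] (hF : IsFiniteFiltration F) :
    F (regIndex F) = ⊤ :=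
  hF.regIndex_le_iff.1 le_rfl

theorem order_le_iff (hF : IsFiniteFiltration F) {f : A} (hf : f ≠ 0) {i : ℤ} :
    order F f ≤ i ↔ f ∈ F i := by
  obtain ⟨b, hb⟩ := hF.exists_eq_bot
  obtain ⟨t, ht⟩ := hF.exists_eq_top
  obtain ⟨d, hd⟩ := exists_forall_iff_le (P := fun i => f ∈ F i)
    (fun _ _ hij h => hF.monotone hij h) ⟨b, by simpa [hb] using hf⟩ ⟨t, by simp [ht]⟩
  have hset : {i : ℤ | f ∈ F i ∧ f ∉ F (i - 1)} = {d} := by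
    ext i
    simp only [Set.mem_ofPred_eq, hd, Set.mem_singleton_iff]
    omega
  rw [order, hset, csInf_singleton, hd]

theorem idealRegIndex_le_iff (hF : IsFiniteFiltration F) {J : Ideal A} (hJ : J ≠ ⊥) {i : ℤ} :
    idealRegIndex F J ≤ i ↔ J.restrictScalars K ≤ F i := by
  obtain ⟨t, ht⟩ := hF.exists_eq_top
  have hbdd : BddAbove {d : ℤ | ∃ f ∈ J, f ≠ 0 ∧ order F f = d} := by
    refine ⟨t, ?_⟩
    rintro _ ⟨f, -, hf, rfl⟩
    exact (hF.order_le_iff hf).2 (ht ▸ Submodule.mem_top)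
  obtain ⟨f, hfJ, hf⟩ := J.ne_bot_iff.1 hJ
  rw [idealRegIndex, csSup_le_iff hbdd ⟨_, f, hfJ, hf, rfl⟩]
  constructor
  · intro h g hg
    by_cases hg0 : g = 0
    · exact hg0 ▸ zero_mem _
    · exact (hF.order_le_iff hg0).1 (h _ ⟨g, hg, hg0, rfl⟩)
  · rintro h _ ⟨g, hg, hg0, rfl⟩
    exact (hF.order_le_iff hg0).2 (h hg)

theorem idealRegIndex_eq_regIndex_iff [Nontrivial A] [Module.Finite K A]
    (hF : IsFiniteFiltration F) {J : Ideal A} (hJ : J ≠ ⊥) :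
    idealRegIndex F J = regIndex F ↔ ¬ J.restrictScalars K ≤ F (regIndex F - 1) := by
  have hle : idealRegIndex F J ≤ regIndex F :=
    (hF.idealRegIndex_le_iff hJ).2 (hF.apply_regIndex ▸ le_top)
  rw [← hF.idealRegIndex_le_iff hJ]
  omega

theorem bddBelow_idealRegIndex (hF : IsFiniteFiltration F) :
    BddBelow (idealRegIndex F '' {J | J ≠ ⊥}) := by
  obtain ⟨b, hb⟩ := hF.exists_eq_bot
  refine ⟨b, ?_⟩
  rintro _ ⟨J, hJ, rfl⟩
  refine le_of_not_ge fun h => hJ ?_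
  simpa [hb] using (hF.idealRegIndex_le_iff hJ).1 h

end IsFiniteFiltration

end FiniteFiltration

/-! ### Cayley-Bacharach property and socle of a local algebra -/

section ArtinianLocal

variable {K : Type*} [Field K] {B : Type*} [CommRing B] [IsLocalRing B] [Algebra K B]

open IsLocalRing (maximalIdeal)

theorem isMinimalPrimaryDecomposition_bot_singleton [IsArtinianRing B] :
    Submodule.IsMinimalPrimaryDecomposition (⊥ : Ideal B) {⊥} where
  inf_eq := Finset.inf_singleton
  primary := by
    intro q hq
    rw [Finset.mem_singleton.1 hq]
    refine Ideal.isPrimary_of_isMaximal_radical ?_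
    change (nilradical B).IsMaximal
    rw [Ring.KrullDimLE.nilradical_eq_maximalIdeal]
    infer_instance
  distinct := by simp
  minimal := by simp

theorem finrank_of_isAtom {J : Ideal B} (hJ : IsAtom J) :
    Module.finrank K J = Module.finrank K (B ⧸ maximalIdeal B) := by
  obtain ⟨m, hm, ⟨e⟩⟩ := isSimpleModule_iff_quot_maximal.1 (isSimpleModule_iff_isAtom.2 hJ)
  rw [← IsLocalRing.eq_maximalIdeal hm]
  exact (e.restrictScalars K).finrank_eq

theorem isAtom_iff_finrank_eq [Module.Finite K B] {J : Ideal B} :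
    IsAtom J ↔ Module.finrank K J = Module.finrank K (B ⧸ maximalIdeal B) := by
  have := IsArtinianRing.of_finite K B
  refine ⟨finrank_of_isAtom, fun h => ?_⟩
  have hJ : J ≠ ⊥ := by
    rintro rfl
    exact Module.finrank_pos.ne (finrank_bot K B ▸ h)
  obtain ⟨J', hatom, hle⟩ := (eq_bot_or_exists_atom_le J).resolve_left hJ
  have heq : J'.restrictScalars K = J.restrictScalars K :=
    Submodule.eq_of_le_of_finrank_eq hle ((finrank_of_isAtom hatom).trans h.symm)
  rwa [← Submodule.restrictScalars_injective K B B heq]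

theorem isMinimalDivisor_maximalIdeal_iff [Module.Finite K B] {J : Ideal B} :
    IsMinimalDivisor K (maximalIdeal B) J ↔ IsAtom J := by
  have := IsArtinianRing.of_finite K B
  refine ⟨fun ⟨_, _, _, _, _, _, h⟩ => isAtom_iff_finrank_eq.2 h, fun h =>
    ⟨{⊥}, isMinimalPrimaryDecomposition_bot_singleton, ⊥, Finset.mem_singleton_self _,
      Ring.KrullDimLE.nilradical_eq_maximalIdeal B, ⟨J, h.bot_lt, ?_⟩, finrank_of_isAtom h⟩⟩
  simp

theorem hasCBP_iff_forall_isAtom [Module.Finite K B] {G : ℤ → Submodule K B}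
    (hG : IsFiniteFiltration G) :
    HasCBP G ↔ ∀ J : Ideal B, IsAtom J → ¬ J.restrictScalars K ≤ G (regIndex G - 1) := by
  have := IsArtinianRing.of_finite K B
  have hsep : sepDegree G (maximalIdeal B) = sInf (idealRegIndex G '' {J | IsAtom J}) := by
    simp only [sepDegree, isMinimalDivisor_maximalIdeal_iff, Set.image, Set.mem_ofPred_eq]
  have hatoms : {J : Ideal B | IsAtom J}.Nonempty := IsAtomic.exists_atom (Ideal B)
  have hCBP : HasCBP G ↔ sepDegree G (maximalIdeal B) = regIndex G :=
    ⟨fun h => h _ inferInstance, fun h m hm => IsLocalRing.eq_maximalIdeal hm ▸ h⟩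
  rw [hCBP, hsep]
  constructor
  · intro h J hJ hle
    have hlt : idealRegIndex G J ≤ regIndex G - 1 := (hG.idealRegIndex_le_iff hJ.1).2 hle
    have hbdd : BddBelow (idealRegIndex G '' {J | IsAtom J}) :=
      hG.bddBelow_idealRegIndex.mono (Set.image_mono fun _ hJ => IsAtom.ne_bot hJ)
    have hge : sInf (idealRegIndex G '' {J | IsAtom J}) ≤ idealRegIndex G J :=
      csInf_le hbdd ⟨J, hJ, rfl⟩
    omega
  · intro h
    have hconst : Set.EqOn (idealRegIndex G) (fun _ => regIndex G) {J | IsAtom J} :=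
      fun J hJ => (hG.idealRegIndex_eq_regIndex_iff hJ.1).2 (h J hJ)
    rw [hconst.image_eq, hatoms.image_const, csInf_singleton]

end ArtinianLocal

section Socle

open IsLocalRing (maximalIdeal)

variable {K : Type*} [Field K] {B : Type*} [CommRing B] [IsLocalRing B] [Algebra K B]

/-- The socle of a local ring: the annihilator of its maximal ideal. -/
def socle (B : Type*) [CommRing B] [IsLocalRing B] : Ideal B :=
  Submodule.torsionBySet B B (maximalIdeal B : Set B)

theorem mem_socle_iff {x : B} : x ∈ socle B ↔ ∀ m ∈ maximalIdeal B, m * x = 0 := by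
  simp [socle, Submodule.mem_torsionBySet_iff]

theorem le_socle_of_isAtom {J : Ideal B} (hJ : IsAtom J) : J ≤ socle B := by
  have := isSimpleModule_iff_isAtom.2 hJ
  have hann : Module.annihilator B J = maximalIdeal B :=
    IsLocalRing.eq_maximalIdeal IsSimpleModule.annihilator_isMaximal
  intro x hx
  refine mem_socle_iff.2 fun m hm => ?_
  exact congrArg Subtype.val (Module.mem_annihilator.1 (hann ▸ hm) ⟨x, hx⟩)

theorem finrank_residueField_eq_one
    (hK : Function.Surjective (algebraMap K (B ⧸ maximalIdeal B))) :
    Module.finrank K (B ⧸ maximalIdeal B) = 1 :=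
  (AlgEquiv.ofBijective (Algebra.ofId K _)
    ⟨(algebraMap K _).injective, hK⟩).toLinearEquiv.finrank_eq.symm.trans (Module.finrank_self K)

theorem isZeroDimGorensteinLocal_iff_finrank_socle [Module.Finite K B]
    (hK : Function.Surjective (algebraMap K (B ⧸ maximalIdeal B))) :
    IsZeroDimGorensteinLocal B ↔ Module.finrank K (socle B) = 1 := by
  let := Ideal.Quotient.field (maximalIdeal B)
  have hfinrank : Module.finrank (B ⧸ maximalIdeal B)
      (Submodule.torsionBySet B B (maximalIdeal B : Set B)) = Module.finrank K (socle B) := by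
    have := Module.finrank_mul_finrank K (B ⧸ maximalIdeal B)
      (Submodule.torsionBySet B B (maximalIdeal B : Set B))
    rwa [finrank_residueField_eq_one hK, one_mul] at this
  rw [← hfinrank]
  exact ⟨fun h => h.socle, fun h => ⟨.of_finite K B, inferInstance, h⟩⟩

theorem restrictScalars_span_singleton_of_mem_socle
    (hK : Function.Surjective (algebraMap K (B ⧸ maximalIdeal B))) {x : B} (hx : x ∈ socle B) :
    (Ideal.span {x}).restrictScalars K = K ∙ x := by
  refine le_antisymm (fun y hy => ?_) (Submodule.span_le_restrictScalars K B {x})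
  obtain ⟨b, rfl⟩ := Ideal.mem_span_singleton'.1 hy
  obtain ⟨c, hc⟩ := hK (Ideal.Quotient.mk _ b)
  have hbc : (algebraMap K B c - b) * x = 0 :=
    mem_socle_iff.1 hx _ (Ideal.Quotient.eq.1 hc)
  refine Submodule.mem_span_singleton.2 ⟨c, ?_⟩
  rwa [sub_mul, sub_eq_zero, ← Algebra.smul_def] at hbc

theorem hasCBP_iff_disjoint_socle [Module.Finite K B]
    (hK : Function.Surjective (algebraMap K (B ⧸ maximalIdeal B)))
    {G : ℤ → Submodule K B} (hG : IsFiniteFiltration G) :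
    HasCBP G ↔ Disjoint ((socle B).restrictScalars K) (G (regIndex G - 1)) := by
  rw [hasCBP_iff_forall_isAtom hG]
  constructor
  · refine fun h => Submodule.disjoint_def.2 fun x hx hxG => by_contra fun hx0 => ?_
    have hspan := restrictScalars_span_singleton_of_mem_socle hK hx
    have hatom : IsAtom (Ideal.span {x}) := by
      rw [isAtom_iff_finrank_eq (K := K), finrank_residueField_eq_one hK]
      change Module.finrank K ((Ideal.span {x}).restrictScalars K) = 1
      rw [hspan, finrank_span_singleton hx0]
    refine h _ hatom ?_
    rwa [hspan, Submodule.span_singleton_le_iff_mem]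
  · intro h J hJ hle
    refine hJ.1 ((Submodule.restrictScalars_eq_bot_iff K B B).1 ?_)
    exact disjoint_self.1 (h.mono (le_socle_of_isAtom hJ) hle)

theorem finrank_eq_one_iff_disjoint_of_isCompl {V : Type*} [AddCommGroup V] [Module K V]
    [Module.Finite K V] {S T W : Submodule K V} (hTS : T ≤ S) (hTW : IsCompl T W) (hW : W ≠ ⊤) :
    Module.finrank K S = 1 ↔ Disjoint S W ∧ Module.finrank K T = 1 := by
  constructor
  · intro hS
    have hT : T ≠ ⊥ := fun hT => hW (by simpa [hT] using hTW.sup_eq_top)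
    have hTS' : T = S := ((Submodule.isAtom_iff_finrank_eq_one.2 hS).le_iff_eq hT).1 hTS
    exact ⟨hTS' ▸ hTW.disjoint, hTS' ▸ hS⟩
  · rintro ⟨hSW, hT⟩
    have hTS' : T = S :=
      eq_of_le_of_inf_le_of_sup_le hTS (hSW.eq_bot.trans_le bot_le)
        (le_top.trans_eq hTW.sup_eq_top.symm)
    exact hTS' ▸ hT

theorem isZeroDimGorensteinLocal_iff_hasCBP_and_finrank [Module.Finite K B]
    (hK : Function.Surjective (algebraMap K (B ⧸ maximalIdeal B)))
    {G : ℤ → Submodule K B} (hG : IsFiniteFiltration G) {T : Submodule K B}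
    (hT : T ≤ (socle B).restrictScalars K) (hTG : IsCompl T (G (regIndex G - 1))) :
    IsZeroDimGorensteinLocal B ↔ HasCBP G ∧ Module.finrank K T = 1 := by
  have hne : G (regIndex G - 1) ≠ ⊤ := fun h => by
    have := hG.regIndex_le_iff.2 h
    omega
  rw [isZeroDimGorensteinLocal_iff_finrank_socle hK, hasCBP_iff_disjoint_socle hK hG]
  exact finrank_eq_one_iff_disjoint_of_isCompl hT hTG hne

end Socle

section LocalCriterion

variable {K : Type*} [Field K] {B : Type*} [CommRing B] [Algebra K B]

theorem isMaximal_of_surjective_algebraMap {M : Ideal B} (hM : M ≠ ⊤)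
    (hK : Function.Surjective (algebraMap K (B ⧸ M))) : M.IsMaximal := by
  have := Ideal.Quotient.nontrivial_iff.2 hM
  have e : K ≃+* B ⧸ M := RingEquiv.ofBijective _ ⟨(algebraMap K _).injective, hK⟩
  exact Ideal.Quotient.maximal_of_isField M (e.symm.toMulEquiv.isField (Field.toIsField K))

theorem isLocalRing_of_le_nilradical {M : Ideal B} [M.IsMaximal] (hM : M ≤ nilradical B) :
    IsLocalRing B := by
  have hnil : nilradical B = M := le_antisymm (nilradical_le_prime M) hM
  exact (((Ring.krullDimLE_zero_and_isLocalRing_tfae B).out 0 3 rfl rfl).2 (hnil ▸ ‹_›)).2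

end LocalCriterion

/-! ### The associated graded ring of a connected filtration -/

theorem isCompl_range_lof_ker_component {R ι : Type*} [Ring R] [DecidableEq ι] {M : ι → Type*}
    [∀ i, AddCommGroup (M i)] [∀ i, Module R (M i)] (i : ι) :
    IsCompl (LinearMap.range (DirectSum.lof R ι M i))
      (LinearMap.ker (DirectSum.component R ι M i)) := by
  refine ⟨Submodule.disjoint_def.2 ?_, codisjoint_iff_le_sup.2 fun g _ => ?_⟩
  · rintro _ ⟨x, rfl⟩ hx
    rw [LinearMap.mem_ker, DirectSum.component.lof_self] at hx
    rw [hx, map_zero]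
  · rw [← add_sub_cancel (DirectSum.lof R ι M i (DirectSum.component R ι M i g)) g]
    refine Submodule.add_mem_sup ⟨_, rfl⟩ ?_
    rw [LinearMap.mem_ker, map_sub, DirectSum.component.lof_self, sub_self]

section AssociatedGraded

variable {K : Type*} [Field K] {A : Type*} [CommRing A] [Algebra K A]

/-- A connected filtration of an algebra: an increasing exhaustive `ℤ`-filtration that is zero in
negative degrees and consists of constants in degree zero. -/
structure IsConnectedFiltration (F : ℤ → Submodule K A) : Prop where
  monotone : Monotone F
  apply_neg_one : F (-1) = ⊥
  apply_zero_le : F 0 ≤ 1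
  exists_eq_top : ∃ i, F i = ⊤

variable {F : ℤ → Submodule K A}

theorem subsingleton_grPiece_iff {i : ℤ} : Subsingleton (GrPiece F i) ↔ F i ≤ F (i - 1) :=
  Submodule.Quotient.subsingleton_iff.trans Submodule.submoduleOf_eq_top

theorem finrank_grPiece [Module.Finite K A] (hF : Monotone F) (i : ℤ) :
    (Module.finrank K (GrPiece F i) : ℤ) = affineHF F i - affineHF F (i - 1) := by
  have hquot := ((F (i - 1)).submoduleOf (F i)).finrank_quotient_add_finrank
  rw [(Submodule.submoduleOfEquivOfLe (hF (sub_one_lt i).le)).finrank_eq] at hquot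
  rw [affineHF, affineHF, ← hquot, Nat.cast_add, add_sub_cancel_right]
  rfl

/-- The filtration of the associated graded ring by degree: its `i`-th piece is the sum of the
homogeneous components of degree at most `i`. -/
def grFiltration (F : ℤ → Submodule K A) (i : ℤ) : Submodule K (Gr F) :=
  ⨅ j ∈ Set.Ioi i, LinearMap.ker (DirectSum.component K ℤ (GrPiece F) j)

theorem mem_grFiltration_iff {i : ℤ} {g : Gr F} : g ∈ grFiltration F i ↔ ∀ j, i < j → g j = 0 := by
  simp only [grFiltration, Submodule.mem_iInf, Set.mem_Ioi, LinearMap.mem_ker]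
  rfl

theorem lof_mem_grFiltration {i j : ℤ} {x : GrPiece F j} (hji : j ≤ i) :
    DirectSum.lof K ℤ (GrPiece F) j x ∈ grFiltration F i :=
  mem_grFiltration_iff.2 fun _ hik => DirectSum.of_eq_of_ne _ _ _ (by omega)

theorem grFiltration_mono : Monotone (grFiltration F) :=
  fun _ _ hij _ hg => mem_grFiltration_iff.2 fun k hk =>
    mem_grFiltration_iff.1 hg k (hij.trans_lt hk)

namespace IsConnectedFiltration

theorem apply_eq_bot (hF : IsConnectedFiltration F) {i : ℤ} (hi : i < 0) : F i = ⊥ :=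
  le_bot_iff.1 ((hF.monotone (by omega)).trans hF.apply_neg_one.le)

theorem isFiniteFiltration (hF : IsConnectedFiltration F) : IsFiniteFiltration F :=
  ⟨hF.monotone, ⟨-1, hF.apply_neg_one⟩, hF.exists_eq_top⟩

theorem subsingleton_grPiece_of_neg (hF : IsConnectedFiltration F) {i : ℤ} (hi : i < 0) :
    Subsingleton (GrPiece F i) :=
  subsingleton_grPiece_iff.2 (hF.apply_eq_bot hi ▸ bot_le)

theorem finrank_range_lof_regIndex [Module.Finite K A] (hF : IsConnectedFiltration F) :
    (Module.finrank K (LinearMap.range (DirectSum.lof K ℤ (GrPiece F) (regIndex F))) : ℤ) =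
      lastDifference F := by
  rw [LinearMap.finrank_range_of_inj (DirectSum.of_injective _), finrank_grPiece hF.monotone,
    lastDifference]

variable [Nontrivial A] [Module.Finite K A]

theorem subsingleton_grPiece_of_regIndex_lt (hF : IsConnectedFiltration F) {i : ℤ}
    (hi : regIndex F < i) : Subsingleton (GrPiece F i) := by
  have htop : F (i - 1) = ⊤ := hF.isFiniteFiltration.regIndex_le_iff.1 (by omega)
  exact subsingleton_grPiece_iff.2 (htop ▸ le_top)

theorem nontrivial_grPiece_regIndex (hF : IsConnectedFiltration F) :
    Nontrivial (GrPiece F (regIndex F)) := by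
  rw [← not_subsingleton_iff_nontrivial, subsingleton_grPiece_iff,
    hF.isFiniteFiltration.apply_regIndex, top_le_iff, ← hF.isFiniteFiltration.regIndex_le_iff]
  omega

theorem nontrivial_gr (hF : IsConnectedFiltration F) : Nontrivial (Gr F) :=
  have := hF.nontrivial_grPiece_regIndex
  (DirectSum.of_injective (β := GrPiece F) (regIndex F)).nontrivial

theorem finite_gr (hF : IsConnectedFiltration F) : Module.Finite K (Gr F) := by
  have (i : ℤ) : Module.Finite K (GrPiece F i) :=
    inferInstanceAs (Module.Finite K (F i ⧸ (F (i - 1)).submoduleOf (F i)))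
  let components : Gr F →ₗ[K] ∀ i : Finset.Icc 0 (regIndex F), GrPiece F i :=
    LinearMap.pi fun i => DirectSum.component K ℤ (GrPiece F) i
  refine Module.Finite.of_injective components fun g h hgh => DFinsupp.ext fun i => ?_
  by_cases hi : i ∈ Finset.Icc 0 (regIndex F)
  · exact congrFun hgh ⟨i, hi⟩
  · rw [Finset.mem_Icc, not_and_or, not_le, not_le] at hi
    have := hi.elim hF.subsingleton_grPiece_of_neg hF.subsingleton_grPiece_of_regIndex_lt
    exact Subsingleton.elim _ _

theorem grFiltration_regIndex (hF : IsConnectedFiltration F) :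
    grFiltration F (regIndex F) = ⊤ := by
  refine eq_top_iff.2 fun g _ => mem_grFiltration_iff.2 fun j hj => ?_
  have := hF.subsingleton_grPiece_of_regIndex_lt hj
  exact Subsingleton.elim _ _

theorem isFiniteFiltration_grFiltration [SetLike.GradedMonoid F] (hF : IsConnectedFiltration F) :
    IsFiniteFiltration (grFiltration F) where
  monotone := grFiltration_mono
  exists_eq_bot := by
    refine ⟨-1, eq_bot_iff.2 fun g hg => DFinsupp.ext fun j => ?_⟩
    by_cases hj : j < 0
    · have := hF.subsingleton_grPiece_of_neg hj
      exact Subsingleton.elim _ _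
    · exact mem_grFiltration_iff.1 hg j (by omega)
  exists_eq_top := ⟨_, hF.grFiltration_regIndex⟩

theorem grFiltration_regIndex_sub_one (hF : IsConnectedFiltration F) :
    grFiltration F (regIndex F - 1) =
      LinearMap.ker (DirectSum.component K ℤ (GrPiece F) (regIndex F)) := by
  ext g
  rw [mem_grFiltration_iff]
  refine ⟨fun h => h _ (sub_one_lt _), fun h j hj => ?_⟩
  obtain rfl | hlt := (Int.le_of_sub_one_lt hj).eq_or_lt
  · exact h
  · have := hF.subsingleton_grPiece_of_regIndex_lt hlt
    exact Subsingleton.elim _ _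

theorem regIndex_grFiltration [SetLike.GradedMonoid F] (hF : IsConnectedFiltration F) :
    regIndex (grFiltration F) = regIndex F := by
  have := hF.finite_gr
  have := hF.nontrivial_gr
  have := hF.nontrivial_grPiece_regIndex
  obtain ⟨x, hx⟩ := exists_ne (0 : GrPiece F (regIndex F))
  have hne : grFiltration F (regIndex F - 1) ≠ ⊤ := fun h => hx <| by
    rw [hF.grFiltration_regIndex_sub_one, LinearMap.ker_eq_top] at h
    simpa [h] using (DirectSum.component.lof_self K (regIndex F) x).symm
  have hle : regIndex (grFiltration F) ≤ regIndex F :=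
    hF.isFiniteFiltration_grFiltration.regIndex_le_iff.2 hF.grFiltration_regIndex
  have hlt := hF.isFiniteFiltration_grFiltration.regIndex_le_iff.not.2 hne
  omega

end IsConnectedFiltration

end AssociatedGraded

section IrrelevantIdeal

variable {K : Type*} [Field K] {A : Type*} [CommRing A] [Algebra K A]
variable {F : ℤ → Submodule K A} [SetLike.GradedMonoid F]

/-- The ideal of the associated graded ring generated by the homogeneous elements of positive
degree. -/
def irrelevantIdeal (F : ℤ → Submodule K A) [SetLike.GradedMonoid F] : Ideal (Gr F) :=
  Ideal.span (⋃ i ∈ Set.Ioi 0, Set.range (DirectSum.of (GrPiece F) i))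

theorem irrelevantIdeal_le_iff {J : Ideal (Gr F)} :
    irrelevantIdeal F ≤ J ↔ ∀ i, 0 < i → ∀ x, DirectSum.of (GrPiece F) i x ∈ J := by
  simp [irrelevantIdeal, Ideal.span_le, Set.range_subset_iff]

theorem of_zero_mk_algebraMap {c : K} {h : algebraMap K A c ∈ F 0} :
    DirectSum.of (GrPiece F) 0 (GrPiece.mk F 0 ⟨algebraMap K A c, h⟩) = algebraMap K (Gr F) c := by
  rw [DirectSum.algebraMap_apply]
  exact congrArg (fun x => DirectSum.of (GrPiece F) 0 (GrPiece.mk F 0 x))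
    (Subtype.ext (Algebra.algebraMap_eq_smul_one c))

namespace IsConnectedFiltration

theorem surjective_algebraMap_quotient_irrelevantIdeal (hF : IsConnectedFiltration F) :
    Function.Surjective (algebraMap K (Gr F ⧸ irrelevantIdeal F)) := by
  refine Ideal.Quotient.mk_surjective.forall.2 fun g => ?_
  change Ideal.Quotient.mk _ g ∈ (algebraMap K (Gr F ⧸ irrelevantIdeal F)).range
  induction g using DirectSum.induction_on with
  | zero => exact map_zero (Ideal.Quotient.mk (irrelevantIdeal F)) ▸ zero_mem _
  | add g h hg hh => exact map_add (Ideal.Quotient.mk (irrelevantIdeal F)) g h ▸ add_mem hg hh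
  | of i x =>
    obtain hi | rfl | hi := lt_trichotomy i 0
    · have := hF.subsingleton_grPiece_of_neg hi
      rw [Subsingleton.elim x 0, map_zero, map_zero]
      exact zero_mem _
    · obtain ⟨⟨_, ha⟩, rfl⟩ := GrPiece.mk_surjective x
      obtain ⟨c, rfl⟩ := Submodule.mem_one.1 (hF.apply_zero_le ha)
      exact ⟨c, congrArg (Ideal.Quotient.mk _) of_zero_mk_algebraMap.symm⟩
    · rw [Ideal.Quotient.eq_zero_iff_mem.2 (irrelevantIdeal_le_iff.1 le_rfl i hi x)]
      exact zero_mem _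

variable [Nontrivial A] [Module.Finite K A]

theorem of_eq_zero_of_regIndex_lt (hF : IsConnectedFiltration F) {i : ℤ} (hi : regIndex F < i)
    (x : GrPiece F i) : DirectSum.of (GrPiece F) i x = 0 := by
  have := hF.subsingleton_grPiece_of_regIndex_lt hi
  rw [Subsingleton.elim x 0, map_zero]

theorem irrelevantIdeal_le_nilradical (hF : IsConnectedFiltration F) :
    irrelevantIdeal F ≤ nilradical (Gr F) := by
  refine irrelevantIdeal_le_iff.2 fun i hi x => ⟨(regIndex F).toNat + 1, ?_⟩
  rw [DirectSum.ofPow]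
  refine hF.of_eq_zero_of_regIndex_lt ?_ _
  rw [nsmul_eq_mul]
  push_cast
  nlinarith [Int.self_le_toNat (regIndex F)]

theorem irrelevantIdeal_isMaximal (hF : IsConnectedFiltration F) :
    (irrelevantIdeal F).IsMaximal := by
  have := hF.nontrivial_gr
  refine isMaximal_of_surjective_algebraMap (fun htop => ?_)
    hF.surjective_algebraMap_quotient_irrelevantIdeal
  have := hF.irrelevantIdeal_le_nilradical (htop ▸ Submodule.mem_top : (1 : Gr F) ∈ _)
  exact not_isNilpotent_one this

theorem isLocalRing_gr (hF : IsConnectedFiltration F) : IsLocalRing (Gr F) :=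
  have := hF.irrelevantIdeal_isMaximal
  isLocalRing_of_le_nilradical hF.irrelevantIdeal_le_nilradical

theorem irrelevantIdeal_eq_maximalIdeal [IsLocalRing (Gr F)] (hF : IsConnectedFiltration F) :
    irrelevantIdeal F = IsLocalRing.maximalIdeal (Gr F) :=
  IsLocalRing.eq_maximalIdeal hF.irrelevantIdeal_isMaximal

theorem range_lof_regIndex_le_socle [IsLocalRing (Gr F)] (hF : IsConnectedFiltration F) :
    LinearMap.range (DirectSum.lof K ℤ (GrPiece F) (regIndex F)) ≤
      (socle (Gr F)).restrictScalars K := by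
  rintro _ ⟨x, rfl⟩
  rw [Submodule.restrictScalars_mem, socle, ← hF.irrelevantIdeal_eq_maximalIdeal,
    irrelevantIdeal, ← Submodule.torsionBySet_eq_torsionBySet_span, Submodule.mem_torsionBySet_iff]
  simp only [Subtype.forall, Set.mem_iUnion, Set.mem_Ioi]
  rintro _ ⟨i, hi, y, rfl⟩
  rw [DirectSum.lof_eq_of, smul_eq_mul, DirectSum.of_mul_of]
  exact hF.of_eq_zero_of_regIndex_lt (by omega) _

theorem isCompl_range_lof_regIndex (hF : IsConnectedFiltration F) :
    IsCompl (LinearMap.range (DirectSum.lof K ℤ (GrPiece F) (regIndex F)))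
      (grFiltration F (regIndex (grFiltration F) - 1)) := by
  rw [hF.regIndex_grFiltration, hF.grFiltration_regIndex_sub_one]
  exact isCompl_range_lof_ker_component _

end IsConnectedFiltration

end IrrelevantIdeal

/-! ### Presentations by polynomial rings -/

section Presentation

variable {K : Type*} [Field K] {n : ℕ}

theorem mem_polyFiltration_iff {i : ℤ} {f : MvPolynomial (Fin n) K} :
    f ∈ polyFiltration K n i ↔ ∀ s, f.coeff s ≠ 0 → (s.degree : ℤ) ≤ i := by
  constructor
  · rintro (rfl | hf) s hs
    · exact absurd (MvPolynomial.coeff_zero s) hs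
    · exact le_trans (mod_cast MvPolynomial.le_totalDegree (MvPolynomial.mem_support_iff.2 hs)) hf
  · refine fun h => or_iff_not_imp_left.2 fun hf => ?_
    obtain ⟨s, hs⟩ := MvPolynomial.support_nonempty.2 hf
    lift i to ℕ using (Int.natCast_nonneg _).trans (h s (MvPolynomial.mem_support_iff.1 hs))
    exact_mod_cast Finset.sup_le fun s hs =>
      Nat.cast_le.1 (h s (MvPolynomial.mem_support_iff.1 hs))

theorem polyFiltration_mono : Monotone (polyFiltration K n) :=
  fun _ _ hij _ hf => mem_polyFiltration_iff.2 fun s hs =>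
    (mem_polyFiltration_iff.1 hf s hs).trans hij

theorem polyFiltration_eq_bot {i : ℤ} (hi : i < 0) : polyFiltration K n i = ⊥ := by
  refine eq_bot_iff.2 fun f hf => MvPolynomial.ext _ _ fun s => not_not.1 fun hs => ?_
  have := mem_polyFiltration_iff.1 hf s hs
  omega

theorem polyFiltration_zero_le : polyFiltration K n 0 ≤ 1 := by
  rintro f (rfl | hf)
  · exact zero_mem _
  · exact Submodule.mem_one.2 ⟨f.coeff 0,
      (MvPolynomial.totalDegree_eq_zero_iff_eq_C.1 (Nat.le_zero.1 (mod_cast hf))).symm⟩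

theorem homogeneousSubmodule_le_polyFiltration (d : ℕ) :
    MvPolynomial.homogeneousSubmodule (Fin n) K d ≤ polyFiltration K n d :=
  fun _ hf => Or.inr (mod_cast MvPolynomial.IsHomogeneous.totalDegree_le hf)

theorem sub_homogeneousComponent_mem_polyFiltration {d : ℕ} {f : MvPolynomial (Fin n) K}
    (hf : f ∈ polyFiltration K n d) :
    f - MvPolynomial.homogeneousComponent d f ∈ polyFiltration K n (d - 1) := by
  refine mem_polyFiltration_iff.2 fun s hs => ?_
  rw [MvPolynomial.coeff_sub, MvPolynomial.coeff_homogeneousComponent] at hs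
  split_ifs at hs with hsd
  · exact absurd (sub_self _) hs
  · have := mem_polyFiltration_iff.1 hf s (by simpa using hs)
    omega

variable {A : Type*} [CommRing A] [Algebra K A] (π : MvPolynomial (Fin n) K →ₐ[K] A)

theorem degFiltration_eq_bot {i : ℤ} (hi : i < 0) : degFiltration π i = ⊥ := by
  rw [degFiltration, polyFiltration_eq_bot hi, Submodule.map_bot]

variable {π} in
theorem isConnectedFiltration_degFiltration [Module.Finite K A] (hπ : Function.Surjective π) :
    IsConnectedFiltration (degFiltration π) where
  monotone _ _ hij := Submodule.map_mono (polyFiltration_mono hij)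
  apply_neg_one := degFiltration_eq_bot π (by norm_num)
  apply_zero_le := (Submodule.map_mono polyFiltration_zero_le).trans (Submodule.map_one π).le
  exists_eq_top := by
    obtain ⟨s, hs⟩ := Module.Finite.fg_top (R := K) (M := A)
    choose f hf using hπ
    refine ⟨((s.sup fun a => (f a).totalDegree : ℕ) : ℤ), top_le_iff.1 ?_⟩
    rw [← hs, Submodule.span_le]
    exact fun a ha => ⟨f a, Or.inr (mod_cast Finset.le_sup (f := fun a => (f a).totalDegree) ha),
      hf a⟩

/-- The symbol of a form of degree `d`: the residue class of its image, as a homogeneous element of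
degree `d` of the associated graded ring. -/
def symbol (d : ℕ) :
    MvPolynomial.homogeneousSubmodule (Fin n) K d →ₗ[K] Gr (degFiltration π) :=
  DirectSum.lof K ℤ (GrPiece (degFiltration π)) d ∘ₗ GrPiece.mk (degFiltration π) d ∘ₗ
    π.toLinearMap.restrict fun f hf => ⟨f, homogeneousSubmodule_le_polyFiltration d hf, rfl⟩

theorem exists_symbol_eq {d : ℕ} (x : GrPiece (degFiltration π) d) :
    ∃ f, symbol π d f = DirectSum.lof K ℤ (GrPiece (degFiltration π)) d x := by
  obtain ⟨⟨_, f, hf, rfl⟩, rfl⟩ := GrPiece.mk_surjective x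
  refine ⟨⟨_, MvPolynomial.homogeneousComponent_mem d f⟩,
    congrArg (DirectSum.lof K ℤ (GrPiece (degFiltration π)) d) (sub_eq_zero.1 ?_).symm⟩
  rw [LinearMap.comp_apply, ← map_sub, GrPiece.mk_eq_zero]
  exact ⟨_, sub_homogeneousComponent_mem_polyFiltration hf, map_sub π _ _⟩

attribute [local instance] MvPolynomial.gradedAlgebra

theorem symbol_one :
    symbol π 0 (GradedMonoid.GOne.one
      (A := fun d => MvPolynomial.homogeneousSubmodule (Fin n) K d)) = 1 :=
  DirectSum.of_eq_of_gradedMonoid_eq (GrPiece.mk_congr Nat.cast_zero (map_one π))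

theorem symbol_mul {d e : ℕ} (f : MvPolynomial.homogeneousSubmodule (Fin n) K d)
    (g : MvPolynomial.homogeneousSubmodule (Fin n) K e) :
    symbol π (d + e) (GradedMonoid.GMul.mul
        (A := fun d => MvPolynomial.homogeneousSubmodule (Fin n) K d) f g) =
      symbol π d f * symbol π e g := by
  simp only [symbol, LinearMap.comp_apply, DirectSum.lof_eq_of, DirectSum.of_mul_of]
  exact DirectSum.of_eq_of_gradedMonoid_eq
    (GrPiece.mk_congr (Nat.cast_add d e) (map_mul π (f : MvPolynomial (Fin n) K) g))

/-- The homomorphism of graded algebras from the polynomial ring to the associated graded ring of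
the degree filtration that sends a form to its symbol. -/
def symbolHom : MvPolynomial (Fin n) K →ₐ[K] Gr (degFiltration π) :=
  (DirectSum.toAlgebra K _ (symbol π) (symbol_one π) (symbol_mul π)).comp
    (DirectSum.decomposeAlgEquiv (MvPolynomial.homogeneousSubmodule (Fin n) K)).toAlgHom

variable {π}

theorem symbolHom_apply {d : ℕ} (f : MvPolynomial.homogeneousSubmodule (Fin n) K d) :
    symbolHom π f = symbol π d f := by
  have hf : DirectSum.decomposeAlgEquiv (MvPolynomial.homogeneousSubmodule (Fin n) K) f =
      DirectSum.of _ d f := DirectSum.decompose_coe _ f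
  exact (congrArg _ hf).trans (DirectSum.toSemiring_of (fun d => (symbol π d).toAddMonoidHom)
    (symbol_one π) (symbol_mul π) d f)

theorem symbolHom_mem_grFiltration {i : ℤ} {f : MvPolynomial (Fin n) K}
    (hf : f ∈ polyFiltration K n i) : symbolHom π f ∈ grFiltration (degFiltration π) i := by
  rw [f.as_sum, map_sum]
  refine Submodule.sum_mem _ fun s hs => ?_
  rw [symbolHom_apply ⟨_, MvPolynomial.isHomogeneous_monomial (f.coeff s) rfl⟩]
  exact lof_mem_grFiltration (mem_polyFiltration_iff.1 hf s (MvPolynomial.mem_support_iff.1 hs))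

theorem lof_mem_degFiltration_symbolHom (i : ℤ) (x : GrPiece (degFiltration π) i) :
    DirectSum.lof K ℤ (GrPiece (degFiltration π)) i x ∈ degFiltration (symbolHom π) i := by
  obtain hi | hi := lt_or_ge i 0
  · have : Subsingleton (GrPiece (degFiltration π) i) :=
      subsingleton_grPiece_iff.2 (degFiltration_eq_bot π hi ▸ bot_le)
    rw [Subsingleton.elim x 0, map_zero]
    exact zero_mem _
  · lift i to ℕ using hi
    obtain ⟨f, hf⟩ := exists_symbol_eq π x
    exact ⟨f, homogeneousSubmodule_le_polyFiltration i f.2, (symbolHom_apply f).trans hf⟩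

theorem degFiltration_symbolHom :
    degFiltration (symbolHom π) = grFiltration (degFiltration π) := by
  classical
  refine funext fun i => le_antisymm ?_ fun g hg => ?_
  · rintro _ ⟨f, hf, rfl⟩
    exact symbolHom_mem_grFiltration hf
  · rw [← DirectSum.sum_support_of g]
    refine Submodule.sum_mem _ fun j hj => ?_
    have hji : j ≤ i := not_lt.1 fun hij =>
      DFinsupp.mem_support_iff.1 hj (mem_grFiltration_iff.1 hg j hij)
    exact Submodule.map_mono (polyFiltration_mono hji) (lof_mem_degFiltration_symbolHom j (g j))

variable (I : Ideal (MvPolynomial (Fin n) K))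

theorem grPresentation_eq_symbolHom : grPresentation I = symbolHom (Ideal.Quotient.mkₐ K I) := by
  refine MvPolynomial.algHom_ext fun k => ?_
  rw [grPresentation, MvPolynomial.aeval_X,
    symbolHom_apply ⟨_, MvPolynomial.isHomogeneous_X K k⟩]
  exact DirectSum.of_eq_of_gradedMonoid_eq (GrPiece.mk_congr Nat.cast_one.symm rfl)

end Presentation

section KrullDimension

variable {R : Type*} [CommRing R]

theorem nontrivial_of_ringKrullDim_eq_zero (hR : ringKrullDim R = 0) : Nontrivial R := by
  by_contra h
  rw [not_nontrivial_iff_subsingleton] at h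
  exact WithBot.bot_ne_zero (ringKrullDim_eq_bot_of_subsingleton.symm.trans hR)

theorem finite_of_ringKrullDim_le_zero {K : Type*} [Field K] [Algebra K R]
    [Algebra.FiniteType K R] (hR : ringKrullDim R ≤ 0) : Module.Finite K R :=
  (Module.finite_iff_krullDimLE_zero K R).2 (Ring.krullDimLE_iff.2 hR)

end KrullDimension

end ZeroDimAffine

end

open ZeroDimAffine in
theorem theorem6p11_general {K : Type*} [Field K] {A : Type*} [CommRing A] [Algebra K A]
    [Nontrivial A] [Module.Finite K A] {F : ℤ → Submodule K A} [SetLike.GradedMonoid F]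
    (hF : IsConnectedFiltration F) :
    IsZeroDimGorensteinLocal (Gr F) ↔ HasCBP (grFiltration F) ∧ lastDifference F = 1 := by
  have := hF.isLocalRing_gr
  have := hF.finite_gr
  have hK : Function.Surjective (algebraMap K (Gr F ⧸ IsLocalRing.maximalIdeal (Gr F))) :=
    hF.irrelevantIdeal_eq_maximalIdeal ▸ hF.surjective_algebraMap_quotient_irrelevantIdeal
  rw [isZeroDimGorensteinLocal_iff_hasCBP_and_finrank hK hF.isFiniteFiltration_grFiltration
    hF.range_lof_regIndex_le_socle hF.isCompl_range_lof_regIndex,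
    ← hF.finrank_range_lof_regIndex, Nat.cast_eq_one]

theorem theorem6p11 {K : Type*} [Field K] {n : ℕ} (I : Ideal (MvPolynomial (Fin n) K))
    (hI : ringKrullDim (MvPolynomial (Fin n) K ⧸ I) = 0) :
    ZeroDimAffine.IsStrictGorenstein I ↔
      ZeroDimAffine.HasStrictCBP I ∧
        ZeroDimAffine.lastDifference (ZeroDimAffine.quotFiltration I) = 1 := by
  have := ZeroDimAffine.nontrivial_of_ringKrullDim_eq_zero hI
  have := ZeroDimAffine.finite_of_ringKrullDim_le_zero (K := K) hI.le
  rw [ZeroDimAffine.HasStrictCBP, ZeroDimAffine.grPresentation_eq_symbolHom,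
    ZeroDimAffine.degFiltration_symbolHom]
  exact theorem6p11_general (ZeroDimAffine.isConnectedFiltration_degFiltration
    (Ideal.Quotient.mkₐ_surjective K I))
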